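/- **Setting.** Let $\Omega\subset\mathbb R^d$ ($d\ge1$) be a convex bounded polygonal domain. Let $\mu$ be a random vector, defined on a complete probability space, with values in a measurable set $\Gamma\subset\mathbb R^m$ and with joint probability density $\rho$. Put $\mathscr H^1(\Omega)=H^1(\Omega)\otimes L^2_\rho(\Gamma)=L^2(\Gamma,\rho\,d\mu;H^1(\Omega))$ and $\mathscr L^2(\Omega)=L^2(\Omega)\otimes L^2_\rho(\Gamma)$, with norms $\|v\|^2=\int_\Gamma\|v(\cdot,\mu)\|^2\rho\,d\mu$. Boundary values are traces in $L^2(\partial\Omega)$, prescribed for almost every $\mu$, and $\mathscr H^1_0(\Omega)=\{v\in\mathscr H^1(\Omega): v|_{\partial\Omega}=0\}$. Let $\mathscr U=\mathscr H^1(\Omega)\times\mathscr L^2(\Omega)$ with $\|(u,f)\|_{\mathscr U}=\|u\|_{\mathscr H^1(\Omega)}+\|f\|_{\mathscr L^2(\Omega)}$, and let $\mathscr U^0=\mathscr H^1_0(\Omega)\times\mathscr L^2(\Omega)$. For $\mu\in\Gamma$ let $a(\cdot,\cdot;\mu)$ be bilinear forms on $H^1(\Omega)$, measurable in $\mu$,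 and let $\tilde\alpha_0,\tilde\alpha_1>0$ be such that for all $\mu\in\Gamma$: $a(v,v;\mu)\ge\tilde\alpha_0\|v\|^2_{H^1(\Omega)}$ for all $v\in H^1_0(\Omega)$, and $a(u,v;\mu)\le\tilde\alpha_1\|u\|_{H^1(\Omega)}\|v\|_{H^1(\Omega)}$ for all $u,v\in H^1(\Omega)$. For random fields write $a(u,v)=\int_\Gamma a(u(\cdot,\mu),v(\cdot,\mu);\mu)\,\rho\,d\mu$, and $(\cdot,\cdot)$ for the inner product of $\mathscr L^2(\Omega)$. Let $\beta>0$, $\hat u\in\mathscr L^2(\Omega)$, $g\in L^2(\partial\Omega)$, and for $\underline u=(u,f)$, $\underline v=(v,h)$ in $\mathscr U$ and $q\in\mathscr H^1(\Omega)$ put $$\mathcal A(\underline u,\underline v)=(u,v)+2\beta(f,h),\qquad \mathcal B(\underline u,q)=a(u,q)-(f,q),$$ $$J(u,f)=\tfrac12\|u-\hat u\|^2_{\mathscr L^2(\Omega)}+\beta\|f\|^2_{\mathscr L^2(\Omega)},\qquad \mathcal J(\underline u)=\tfrac12\mathcal A(\underline u,\underline u)-(\hat u,u),$$ $$\mathscr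 U_0=\{\underline u\in\mathscr U:\ \mathcal B(\underline u,\tilde u)=0\ \ \forall\,\tilde u\in\mathscr H^1_0(\Omega)\}.$$ **Lemma.** 1. $\mathcal A$ is symmetric and nonnegative, and $|\mathcal A(\underline u,\underline v)|\le\max\{1,2\beta\}\|\underline u\|_{\mathscr U}\|\underline v\|_{\mathscr U}$ on $\mathscr U$. On the elements of the kernel $\mathscr U_0$ whose state vanishes on $\partial\Omega$ it is coercive: $\mathcal A(\underline u,\underline u)\ge2\beta\big(\tfrac{\tilde\alpha_0}{1+\tilde\alpha_0}\big)^2\|\underline u\|^2_{\mathscr U}$ for all $\underline u\in\mathscr U_0\cap\mathscr U^0$. 2. The integral defining $a(u,v)$ converges absolutely for all $u,v\in\mathscr H^1(\Omega)$. For all $\underline u\in\mathscr U$ and $q\in\mathscr H^1(\Omega)$, $|\mathcal B(\underline u,q)|\le\max\{\tilde\alpha_1,1\}\|\underline u\|_{\mathscr U}\|q\|_{\mathscr H^1(\Omega)}$. The inf-sup condition holds: $\sup_{0\ne\underline u\in\mathscr U}\mathcal B(\underline u,q)/\|\underline u\|_{\mathscr U}\ge\tilde\alpha_0\|q\|_{\mathscr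 H^1(\Omega)}$ for all $q\in\mathscr H^1_0(\Omega)$. 3. Let $(\mathscr U_{ad},\mathscr V)$ be either $(\mathscr U,\mathscr U)$ (no boundary condition) or $\big(\{(u,f)\in\mathscr U:u|_{\partial\Omega}=g\},\ \mathscr U^0\big)$ (Dirichlet condition). Then $\underline u\in\mathscr U$ solves $$\min_{\underline u\in\mathscr U_{ad}}\mathcal J(\underline u)\quad\text{s.t. }\ \mathcal B(\underline u,\tilde u)=0\ \ \forall\,\tilde u\in\mathscr H^1_0(\Omega)$$ if and only if $\underline u\in\mathscr U_{ad}$ and there is a unique $\lambda\in\mathscr H^1_0(\Omega)$ such that $(\underline u,\lambda)$ solves the saddle-point problem $$\mathcal A(\underline u,\underline v)+\mathcal B(\underline v,\lambda)=(\hat u,v)\ \ \forall\,\underline v=(v,h)\in\mathscr V,\qquad \mathcal B(\underline u,\tilde u)=0\ \ \forall\,\tilde u\in\mathscr H^1_0(\Omega).$$ 4. A pair $(u,f)\in\mathscr U$ solves the original problem of minimizing $J(u,f)$ over $\mathscr U$ subject to $a(u,v)=(f,v)$ for all $v\in\mathscr H^1_0(\Omega)$ and $u|_{\partial\Omega}=g$,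 if and only if $u|_{\partial\Omega}=g$ and there is a unique $\lambda\in\mathscr H^1_0(\Omega)$ such that the optimality system holds: $$a(u,\tilde u)=(f,\tilde u)\ \ \forall\,\tilde u\in\mathscr H^1_0(\Omega),\qquad a(\tilde\lambda,\lambda)=-(u-\hat u,\tilde\lambda)\ \ \forall\,\tilde\lambda\in\mathscr H^1_0(\Omega),\qquad 2\beta(f,\tilde f)=(\tilde f,\lambda)\ \ \forall\,\tilde f\in\mathscr L^2(\Omega).$$ -/

import Mathlib

open MeasureTheory
open scoped ENNReal ContDiff

noncomputable section

namespace StochOC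

/-- The Euclidean space `ℝᵈ`. -/
abbrev E (d : ℕ) : Type := EuclideanSpace ℝ (Fin d)

/-- `Ω` is a convex bounded polygonal (polytopal) domain of `ℝᵈ`: a nonempty open set that is the
interior of the convex hull of finitely many points. Such a set has a Lipschitz boundary. -/
def IsConvexPolygonalDomain {d : ℕ} (Ω : Set (E d)) : Prop :=
  Ω.Nonempty ∧ ∃ S : Finset (E d), Ω = interior (convexHull ℝ (S : Set (E d)))

/-! ### Function spaces on the physical domain -/

/-- `L²(Ω)`. -/
abbrev L2 {d : ℕ} (Ω : Set (E d)) : Type := Lp ℝ 2 (volume.restrict Ω)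

/-- `L²(Ω; ℝᵈ)`. -/
abbrev L2vec {d : ℕ} (Ω : Set (E d)) : Type := Lp (E d) 2 (volume.restrict Ω)

/-- `w` is the weak gradient of `u` on `Ω`:
`∫_Ω u ∇φ = - ∫_Ω φ w` for all `φ ∈ C_c^∞(Ω)`. -/
def IsWeakGradient {d : ℕ} (Ω : Set (E d)) (u : L2 Ω) (w : L2vec Ω) : Prop :=
  ∀ φ : E d → ℝ, ContDiff ℝ ∞ φ → HasCompactSupport φ → tsupport φ ⊆ Ω →
    ∫ x in Ω, u x • gradient φ x = - ∫ x in Ω, φ x • w x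

theorem memLp_gradient {d : ℕ} (Ω : Set (E d)) {φ : E d → ℝ} (h : ContDiff ℝ ∞ φ)
    (hc : HasCompactSupport φ) : MemLp (gradient φ) 2 (volume.restrict Ω) := by
  have h1 : Continuous (gradient φ) :=
    (InnerProductSpace.toDual ℝ (E d)).symm.continuous.comp (h.continuous_fderiv (by simp))
  have h2 : HasCompactSupport (gradient φ) :=
    (hc.fderiv (𝕜 := ℝ)).comp_left (g := (InnerProductSpace.toDual ℝ (E d)).symm) (map_zero _)
  exact (h1.memLp_of_hasCompactSupport h2).restrict Ω

theorem integrable_smul_gradient {d : ℕ} (Ω : Set (E d)) (u : L2 Ω) {φ : E d → ℝ}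
    (h : ContDiff ℝ ∞ φ) (hc : HasCompactSupport φ) :
    Integrable (fun x => u x • gradient φ x) (volume.restrict Ω) :=
  memLp_one_iff_integrable.1 ((memLp_gradient Ω h hc).smul (Lp.memLp u))

theorem integrable_smul_weak {d : ℕ} (Ω : Set (E d)) (w : L2vec Ω) {φ : E d → ℝ}
    (h : ContDiff ℝ ∞ φ) (hc : HasCompactSupport φ) :
    Integrable (fun x => φ x • w x) (volume.restrict Ω) :=
  memLp_one_iff_integrable.1
    ((Lp.memLp w).smul ((h.continuous.memLp_of_hasCompactSupport (p := 2) hc).restrict Ω))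

/-- The Sobolev space `H¹(Ω)`: pairs `(u, w)` with `u ∈ L²(Ω)` and `w = ∇u ∈ L²(Ω; ℝᵈ)` its weak
gradient, with the norm `(‖u‖² + ‖∇u‖²)^{1/2}`. -/
def H1 {d : ℕ} (Ω : Set (E d)) : Submodule ℝ (WithLp 2 (L2 Ω × L2vec Ω)) where
  carrier := {p | IsWeakGradient Ω p.fst p.snd}
  zero_mem' := by
    intro φ _ _ _
    have h1 : (fun x => (0 : L2 Ω) x • gradient φ x) =ᵐ[volume.restrict Ω] fun _ => 0 := by
      filter_upwards [Lp.coeFn_zero ℝ 2 (volume.restrict Ω)] with x hx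
      rw [hx, Pi.zero_apply, zero_smul]
    have h2 : (fun x => φ x • (0 : L2vec Ω) x) =ᵐ[volume.restrict Ω] fun _ => 0 := by
      filter_upwards [Lp.coeFn_zero (E d) 2 (volume.restrict Ω)] with x hx
      rw [hx, Pi.zero_apply, smul_zero]
    have e1 := integral_congr_ae h1
    have e2 := integral_congr_ae h2
    simp only [integral_zero] at e1 e2
    change ∫ x in Ω, (0 : L2 Ω) x • gradient φ x = - ∫ x in Ω, φ x • (0 : L2vec Ω) x
    rw [e1, e2, neg_zero]
  add_mem' := by
    intro p q hp hq φ h hc hs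
    have h1 : (fun x => (p.fst + q.fst) x • gradient φ x) =ᵐ[volume.restrict Ω]
        fun x => p.fst x • gradient φ x + q.fst x • gradient φ x := by
      filter_upwards [Lp.coeFn_add p.fst q.fst] with x hx
      rw [hx, Pi.add_apply, add_smul]
    have h2 : (fun x => φ x • (p.snd + q.snd) x) =ᵐ[volume.restrict Ω]
        fun x => φ x • p.snd x + φ x • q.snd x := by
      filter_upwards [Lp.coeFn_add p.snd q.snd] with x hx
      rw [hx, Pi.add_apply, smul_add]
    change ∫ x in Ω, (p.fst + q.fst) x • gradient φ x = - ∫ x in Ω, φ x • (p.snd + q.snd) x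
    rw [integral_congr_ae h1, integral_congr_ae h2,
      integral_add (integrable_smul_gradient Ω _ h hc) (integrable_smul_gradient Ω _ h hc),
      integral_add (integrable_smul_weak Ω _ h hc) (integrable_smul_weak Ω _ h hc),
      hp φ h hc hs, hq φ h hc hs, neg_add]
  smul_mem' := by
    intro c p hp φ h hc hs
    have h1 : (fun x => (c • p.fst) x • gradient φ x) =ᵐ[volume.restrict Ω]
        fun x => c • (p.fst x • gradient φ x) := by
      filter_upwards [Lp.coeFn_smul c p.fst] with x hx
      simp [hx, mul_smul]
    have h2 : (fun x => φ x • (c • p.snd) x) =ᵐ[volume.restrict Ω]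
        fun x => c • (φ x • p.snd x) := by
      filter_upwards [Lp.coeFn_smul c p.snd] with x hx
      simp only [hx, Pi.smul_apply]
      rw [smul_comm]
    change ∫ x in Ω, (c • p.fst) x • gradient φ x = - ∫ x in Ω, φ x • (c • p.snd) x
    rw [integral_congr_ae h1, integral_congr_ae h2, integral_smul, integral_smul,
      hp φ h hc hs, smul_neg]

/-- The inclusion `H¹(Ω) → L²(Ω)`. -/
def H1.toL2 {d : ℕ} (Ω : Set (E d)) : H1 Ω →L[ℝ] L2 Ω :=
  (WithLp.fstL 2 ℝ (L2 Ω) (L2vec Ω)).comp (H1 Ω).subtypeL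

/-- Surface measure on `∂Ω`. -/
def surfaceMeasure {d : ℕ} (Ω : Set (E d)) : Measure (E d) :=
  (μH[(d : ℝ) - 1]).restrict (frontier Ω)

/-- `L²(∂Ω)`. -/
abbrev L2Bdry {d : ℕ} (Ω : Set (E d)) : Type := Lp ℝ 2 (surfaceMeasure Ω)

/-- The pairs `(φ|_Ω, φ|_{∂Ω}) ∈ H¹(Ω) × L²(∂Ω)` with `φ` smooth on `ℝᵈ`. -/
def smoothTraceGraph {d : ℕ} (Ω : Set (E d)) : Submodule ℝ (H1 Ω × L2Bdry Ω) where
  carrier := {p | ∃ φ : E d → ℝ, ContDiff ℝ ∞ φ ∧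
    H1.toL2 Ω p.1 =ᵐ[volume.restrict Ω] φ ∧ p.2 =ᵐ[surfaceMeasure Ω] φ}
  zero_mem' := by
    refine ⟨fun _ => 0, contDiff_const, ?_, ?_⟩
    · rw [Prod.fst_zero, map_zero]
      exact Lp.coeFn_zero ℝ 2 (volume.restrict Ω)
    · exact Lp.coeFn_zero ℝ 2 (surfaceMeasure Ω)
  add_mem' := by
    rintro p q ⟨φ, hφ, h1, h2⟩ ⟨ψ, hψ, h3, h4⟩
    refine ⟨φ + ψ, hφ.add hψ, ?_, ?_⟩
    · rw [Prod.fst_add, map_add]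
      exact (Lp.coeFn_add _ _).trans (h1.add h3)
    · exact (Lp.coeFn_add _ _).trans (h2.add h4)
  smul_mem' := by
    rintro c p ⟨φ, hφ, h1, h2⟩
    refine ⟨c • φ, contDiff_const.smul hφ, ?_, ?_⟩
    · rw [Prod.smul_fst, map_smul]
      exact (Lp.coeFn_smul _ _).trans (h1.const_smul c)
    · exact (Lp.coeFn_smul _ _).trans (h2.const_smul c)

/-- The graph of the trace operator `H¹(Ω) → L²(∂Ω)`: the closure of the graph of the restriction
`φ|_Ω ↦ φ|_{∂Ω}` on smooth functions. -/
def traceGraph {d : ℕ} (Ω : Set (E d)) : Submodule ℝ (H1 Ω × L2Bdry Ω) :=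
  (smoothTraceGraph Ω).topologicalClosure

/-- `u|_{∂Ω} = g` in the sense of traces. -/
def HasTrace {d : ℕ} (Ω : Set (E d)) (u : H1 Ω) (g : L2Bdry Ω) : Prop :=
  (u, g) ∈ traceGraph Ω

/-- `H¹₀(Ω) = {u ∈ H¹(Ω) : u|_{∂Ω} = 0}`. -/
def H10 {d : ℕ} (Ω : Set (E d)) : Submodule ℝ (H1 Ω) :=
  (traceGraph Ω).comap (LinearMap.inl ℝ (H1 Ω) (L2Bdry Ω))

theorem mem_H10 {d : ℕ} (Ω : Set (E d)) (u : H1 Ω) : u ∈ H10 Ω ↔ HasTrace Ω u 0 := Iff.rfl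

/-! ### Function spaces of random fields

`P` is a measure on the parameter space; it is `ρ dμ` on `Γ` in the theorem. -/

/-- The measure `ρ dμ` on `Γ`. -/
def paramMeasure {m : ℕ} (Γ : Set (E m)) (ρ : E m → ℝ≥0∞) : Measure (E m) :=
  (volume.restrict Γ).withDensity ρ

section Fields

variable {d m : ℕ} (Ω : Set (E d)) (P : Measure (E m))

/-- `𝓗¹(Ω) = H¹(Ω) ⊗ L²_ρ(Γ)`, i.e. `L²(Γ, ρ dμ; H¹(Ω))`, with norm
`(∫ ‖v(·,μ)‖²_{H¹(Ω)} ρ dμ)^{1/2}`. -/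
abbrev RH1 : Type := Lp (H1 Ω) 2 P

/-- `𝓛²(Ω) = L²(Ω) ⊗ L²_ρ(Γ)`, i.e. `L²(Γ, ρ dμ; L²(Ω))`. -/
abbrev RL2 : Type := Lp (L2 Ω) 2 P

/-- The inclusion `𝓗¹(Ω) → 𝓛²(Ω)`. -/
def RH1.toRL2 : RH1 Ω P →L[ℝ] RL2 Ω P :=
  (H1.toL2 Ω).compLpL 2 P

/-- `𝓗¹₀(Ω)`: random fields with `v(·,μ)|_{∂Ω} = 0` almost surely. -/
def RH10 : Submodule ℝ (RH1 Ω P) where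
  carrier := {v | ∀ᵐ y ∂P, v y ∈ H10 Ω}
  zero_mem' := by
    filter_upwards [Lp.coeFn_zero (H1 Ω) 2 P] with y hy
    rw [hy]
    exact (H10 Ω).zero_mem
  add_mem' := by
    intro u v hu hv
    change ∀ᵐ y ∂P, (u + v) y ∈ H10 Ω
    filter_upwards [Lp.coeFn_add u v, hu, hv] with y hy h1 h2
    rw [hy]
    exact (H10 Ω).add_mem h1 h2
  smul_mem' := by
    intro c u hu
    change ∀ᵐ y ∂P, (c • u) y ∈ H10 Ω
    filter_upwards [Lp.coeFn_smul c u, hu] with y hy h1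
    rw [hy]
    exact (H10 Ω).smul_mem c h1

/-- `𝓤 = 𝓗¹(Ω) × 𝓛²(Ω)`, the space of pairs (state, control). -/
abbrev UU : Type := RH1 Ω P × RL2 Ω P

variable {Ω P}

/-- The graph norm `‖u‖_{𝓗¹} + ‖f‖_{𝓛²}` of `(u, f) ∈ 𝓤`. -/
def graphNorm (U : UU Ω P) : ℝ := ‖U.1‖ + ‖U.2‖

/-- The Dirichlet condition `u|_{∂Ω} = g` on the state, almost surely. -/
def dirichletSet (g : L2Bdry Ω) : Set (UU Ω P) :=
  {U | ∀ᵐ y ∂P, HasTrace Ω (U.1 y) g}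

variable (Ω P) in
/-- `𝓗¹₀(Ω) × 𝓛²(Ω)`, the pairs whose state vanishes on `∂Ω`. -/
def UU0 : Submodule ℝ (UU Ω P) := (RH10 Ω P).prod ⊤

/-! ### Forms and functionals -/

/-- A family `a(·,·;μ)` of bilinear forms on `H¹(Ω)`. -/
abbrev FormFamily (m : ℕ) {d : ℕ} (Ω : Set (E d)) : Type := E m → H1 Ω →ₗ[ℝ] H1 Ω →ₗ[ℝ] ℝ

/-- The form `a` on random fields: `∫ a(u(·,μ), v(·,μ); μ) ρ dμ`. -/
def aForm (a : FormFamily m Ω) (u v : RH1 Ω P) : ℝ :=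
  ∫ y, a y (u y) (v y) ∂P

/-- `𝓐((u,f),(v,h)) = (u,v) + 2β(f,h)`. -/
def AForm (β : ℝ) (U V : UU Ω P) : ℝ :=
  inner ℝ (RH1.toRL2 Ω P U.1) (RH1.toRL2 Ω P V.1) + 2 * β * inner ℝ U.2 V.2

/-- `𝓑((u,f),q) = a(u,q) - (f,q)`. -/
def BForm (a : FormFamily m Ω) (U : UU Ω P) (q : RH1 Ω P) : ℝ :=
  aForm a U.1 q - inner ℝ U.2 (RH1.toRL2 Ω P q)

/-- The kernel `𝓤₀` of `𝓑`. -/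
def kerB (a : FormFamily m Ω) : Set (UU Ω P) :=
  {U | ∀ q ∈ RH10 Ω P, BForm a U q = 0}

/-- The cost `J(u,f) = ½‖u - û‖² + β‖f‖²`, norms in `𝓛²(Ω)`. -/
def cost (β : ℝ) (uhat : RL2 Ω P) (U : UU Ω P) : ℝ :=
  1 / 2 * ‖RH1.toRL2 Ω P U.1 - uhat‖ ^ 2 + β * ‖U.2‖ ^ 2

/-- The quadratic functional `½ 𝓐(U,U) - (û,u)` for `U = (u,f)`. -/
def quadCost (β : ℝ) (uhat : RL2 Ω P) (U : UU Ω P) : ℝ :=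
  1 / 2 * AForm β U U - inner ℝ uhat (RH1.toRL2 Ω P U.1)

/-! ### The problems -/

/-- The original control problem: `(u,f)` minimizes `J` among all `(u,f) ∈ 𝓤` that satisfy
`u|_{∂Ω} = g` and `a(u,v) = (f,v)` for all `v ∈ 𝓗¹₀(Ω)`. -/
def IsOptimalControl (a : FormFamily m Ω) (β : ℝ) (uhat : RL2 Ω P) (g : L2Bdry Ω)
    (U : UU Ω P) : Prop :=
  let feasible : Set (UU Ω P) := {W | W ∈ dirichletSet g ∧
    ∀ v ∈ RH10 Ω P, aForm a W.1 v = inner ℝ W.2 (RH1.toRL2 Ω P v)}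
  U ∈ feasible ∧ ∀ W ∈ feasible, cost β uhat U ≤ cost β uhat W

/-- The constrained quadratic minimization over the admissible set `Uad`:
`U` minimizes `½ 𝓐(U,U) - (û,u)` over all `U ∈ Uad` with `𝓑(U,q) = 0` for all `q ∈ 𝓗¹₀(Ω)`. -/
def IsQuadMinimizer (Uad : Set (UU Ω P)) (a : FormFamily m Ω) (β : ℝ) (uhat : RL2 Ω P)
    (U : UU Ω P) : Prop :=
  let feasible : Set (UU Ω P) := {W | W ∈ Uad ∧ ∀ q ∈ RH10 Ω P, BForm a W q = 0}
  U ∈ feasible ∧ ∀ W ∈ feasible, quadCost β uhat U ≤ quadCost β uhat W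

/-- The saddle-point problem with admissible set `Uad` and space `V` of test pairs: `U ∈ Uad`,
`lam ∈ 𝓗¹₀(Ω)`, `𝓐(U,V) + 𝓑(V,lam) = (û,v)` for all `V = (v,h)` in the test space, and
`𝓑(U,q) = 0` for all `q ∈ 𝓗¹₀(Ω)`. -/
def IsSaddlePoint (Uad : Set (UU Ω P)) (V : Submodule ℝ (UU Ω P)) (a : FormFamily m Ω) (β : ℝ)
    (uhat : RL2 Ω P) (U : UU Ω P) (lam : RH1 Ω P) : Prop :=
  U ∈ Uad ∧ lam ∈ RH10 Ω P ∧
  (∀ W ∈ V, AForm β U W + BForm a W lam = inner ℝ uhat (RH1.toRL2 Ω P W.1)) ∧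
  (∀ q ∈ RH10 Ω P, BForm a U q = 0)

/-- The optimality system: boundary condition, state, adjoint and gradient equation. -/
def IsOptimalitySystemSol (a : FormFamily m Ω) (β : ℝ) (uhat : RL2 Ω P) (g : L2Bdry Ω)
    (U : UU Ω P) (lam : RH1 Ω P) : Prop :=
  U ∈ dirichletSet g ∧ lam ∈ RH10 Ω P ∧
  (∀ v ∈ RH10 Ω P, aForm a U.1 v = inner ℝ U.2 (RH1.toRL2 Ω P v)) ∧
  (∀ v ∈ RH10 Ω P,
    aForm a v lam = - inner ℝ (RH1.toRL2 Ω P U.1 - uhat) (RH1.toRL2 Ω P v)) ∧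
  (∀ h : RL2 Ω P, 2 * β * inner ℝ U.2 h = inner ℝ h (RH1.toRL2 Ω P lam))

end Fields

end StochOC

end

/-!
The forms `a(·,·;μ)` are measurable in the parameter and continuous in their arguments, so they
integrate to a bounded bilinear form on `L²(P; H¹(Ω))`, which is coercive on `𝓗¹₀(Ω)`. Testing
`𝓑(U, U.1) = 0` shows that on the kernel of `𝓑` the control dominates the state, hence `𝓐` is
coercive there; testing with `(q, 0)` gives the inf-sup condition.

A minimizer of the convex functional `𝓙` over an affine set is characterized by the vanishing of the
residual `𝓐(U, ·) - (û, ·)` on the admissible directions in the kernel of `𝓑`. Since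
`w ↦ 𝓑((w, 0), ·)` is coercive on `𝓗¹₀(Ω)`, the Lax–Milgram theorem corrects any admissible
direction to one in the kernel and represents the residual by exactly one multiplier
`λ ∈ 𝓗¹₀(Ω)`. Finally `J` differs from `𝓙` by a constant, and the saddle-point equation tested
separately with states and with controls is the pair of adjoint and gradient equations.
-/

namespace StochOC

/-! ### Random bilinear forms -/

section Caratheodory

variable {α β γ : Type*} [MeasurableSpace α] {μ : Measure α} [MeasurableSpace γ] {F : α → β → γ}

theorem aemeasurable_apply_simpleFunc (hF : ∀ b, AEMeasurable (fun x => F x b) μ)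
    (s : SimpleFunc α β) : AEMeasurable (fun x => F x (s x)) μ := by
  have hmk : ∀ᵐ x ∂μ, ∀ b ∈ Set.range s, F x b = (hF b).mk _ x :=
    s.finite_range.eventually_all.2 fun b _ => (hF b).ae_eq_mk
  exact ⟨fun x => (hF (s x)).mk _ x, s.measurable_bind _ fun b => (hF b).measurable_mk,
    hmk.mono fun x hx => hx _ ⟨x, rfl⟩⟩

theorem aemeasurable_apply_of_continuous [TopologicalSpace β] [TopologicalSpace γ]
    [TopologicalSpace.PseudoMetrizableSpace γ] [BorelSpace γ]
    (hF : ∀ b, AEMeasurable (fun x => F x b) μ) (hcont : ∀ᵐ x ∂μ, Continuous (F x))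
    {f : α → β} (hf : AEStronglyMeasurable f μ) : AEMeasurable (fun x => F x (f x)) μ := by
  refine aemeasurable_of_tendsto_metrizable_ae' (fun n =>
    aemeasurable_apply_simpleFunc hF (hf.stronglyMeasurable_mk.approx n)) ?_
  filter_upwards [hcont, hf.ae_eq_mk] with x hx hfx
  rw [hfx]
  exact (hx.tendsto _).comp (hf.stronglyMeasurable_mk.tendsto_approx x)

end Caratheodory

theorem abs_le_mul_norm_mul_norm {G H : Type*} [SeminormedAddCommGroup G] [Module ℝ G]
    [SeminormedAddCommGroup H] [Module ℝ H] {b : G →ₗ[ℝ] H →ₗ[ℝ] ℝ} {C : ℝ}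
    (hb : ∀ u v, b u v ≤ C * ‖u‖ * ‖v‖) (u : G) (v : H) : |b u v| ≤ C * ‖u‖ * ‖v‖ := by
  refine abs_le'.2 ⟨hb u v, ?_⟩
  simpa only [map_neg, LinearMap.neg_apply, norm_neg] using hb (-u) v

section NormProduct

variable {α G H : Type*} [MeasurableSpace α] {μ : Measure α} [NormedAddCommGroup G]
  [NormedAddCommGroup H]

theorem integrable_norm_mul_norm (u : Lp G 2 μ) (v : Lp H 2 μ) :
    Integrable (fun y => ‖u y‖ * ‖v y‖) μ :=
  (Lp.memLp u).norm.integrable_mul (Lp.memLp v).norm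

theorem integral_norm_mul_norm_le (u : Lp G 2 μ) (v : Lp H 2 μ) :
    ∫ y, ‖u y‖ * ‖v y‖ ∂μ ≤ ‖u‖ * ‖v‖ := by
  have hu := (Lp.memLp u).norm
  have hv := (Lp.memLp v).norm
  calc ∫ y, ‖u y‖ * ‖v y‖ ∂μ = inner ℝ (hv.toLp _) (hu.toLp _) := by
        rw [L2.inner_def]
        refine integral_congr_ae ?_
        filter_upwards [hu.coeFn_toLp, hv.coeFn_toLp] with y huy hvy
        rw [huy, hvy, real_inner_eq_re_inner, RCLike.inner_apply]
        rfl
    _ ≤ ‖hv.toLp _‖ * ‖hu.toLp _‖ := real_inner_le_norm _ _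
    _ = ‖u‖ * ‖v‖ := by
        rw [Lp.norm_toLp, Lp.norm_toLp, eLpNorm_norm, eLpNorm_norm, ← Lp.norm_def, ← Lp.norm_def,
          mul_comm]

end NormProduct

/-- A random bilinear form on `H`: a family of bilinear forms over a measure space that is weakly
measurable and almost everywhere bounded by the constant `C`. Boundedness is one-sided because
changing the sign of an argument yields the lower bound. -/
structure IsBoundedFormFamily {α H : Type*} [MeasurableSpace α] [NormedAddCommGroup H]
    [NormedSpace ℝ H] (μ : Measure α) (a : α → H →ₗ[ℝ] H →ₗ[ℝ] ℝ) (C : ℝ) : Prop where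
  aemeasurable : ∀ u v, AEMeasurable (fun y => a y u v) μ
  bound_nonneg : 0 ≤ C
  le_bound : ∀ᵐ y ∂μ, ∀ u v, a y u v ≤ C * ‖u‖ * ‖v‖

namespace IsBoundedFormFamily

variable {α H : Type*} [MeasurableSpace α] {μ : Measure α}

section NormedSpace

variable [NormedAddCommGroup H] [NormedSpace ℝ H] {a : α → H →ₗ[ℝ] H →ₗ[ℝ] ℝ} {C : ℝ}

theorem aemeasurable_apply (ha : IsBoundedFormFamily μ a C) {u v : α → H}
    (hu : AEStronglyMeasurable u μ) (hv : AEStronglyMeasurable v μ) :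
    AEMeasurable (fun y => a y (u y) (v y)) μ := by
  refine aemeasurable_apply_of_continuous (F := fun y (p : H × H) => a y p.1 p.2)
    (fun p => ha.aemeasurable p.1 p.2) ?_ (hu.prodMk hv)
  filter_upwards [ha.le_bound] with y hy
  exact ((a y).mkContinuous₂ C (abs_le_mul_norm_mul_norm hy)).continuous₂

theorem ae_norm_apply_le (ha : IsBoundedFormFamily μ a C) (u v : α → H) :
    ∀ᵐ y ∂μ, ‖a y (u y) (v y)‖ ≤ C * (‖u y‖ * ‖v y‖) := by
  filter_upwards [ha.le_bound] with y hy
  rw [← mul_assoc]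
  exact abs_le_mul_norm_mul_norm hy _ _

theorem integrable (ha : IsBoundedFormFamily μ a C) (u v : Lp H 2 μ) :
    Integrable (fun y => a y (u y) (v y)) μ :=
  ((integrable_norm_mul_norm u v).const_mul C).mono'
    (ha.aemeasurable_apply (Lp.aestronglyMeasurable u)
      (Lp.aestronglyMeasurable v)).aestronglyMeasurable (ha.ae_norm_apply_le u v)

theorem norm_integral_le (ha : IsBoundedFormFamily μ a C) (u v : Lp H 2 μ) :
    ‖∫ y, a y (u y) (v y) ∂μ‖ ≤ C * ‖u‖ * ‖v‖ :=
  calc ‖∫ y, a y (u y) (v y) ∂μ‖ ≤ ∫ y, C * (‖u y‖ * ‖v y‖) ∂μ :=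
        norm_integral_le_of_norm_le ((integrable_norm_mul_norm u v).const_mul C)
          (ha.ae_norm_apply_le u v)
    _ = C * ∫ y, ‖u y‖ * ‖v y‖ ∂μ := integral_const_mul _ _
    _ ≤ C * (‖u‖ * ‖v‖) :=
        mul_le_mul_of_nonneg_left (integral_norm_mul_norm_le u v) ha.bound_nonneg
    _ = C * ‖u‖ * ‖v‖ := (mul_assoc _ _ _).symm

/-- The bounded bilinear form `(u, v) ↦ ∫ a(u(y), v(y); y) dμ` that a random bilinear form on `H`
induces on `L²(μ; H)`. -/
noncomputable def lpForm (ha : IsBoundedFormFamily μ a C) : Lp H 2 μ →L[ℝ] Lp H 2 μ →L[ℝ] ℝ :=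
  LinearMap.mkContinuous₂
    (LinearMap.mk₂ ℝ (fun u v : Lp H 2 μ => ∫ y, a y (u y) (v y) ∂μ)
      (fun u u' v => by
        rw [← integral_add (ha.integrable u v) (ha.integrable u' v)]
        refine integral_congr_ae ?_
        filter_upwards [Lp.coeFn_add u u'] with y hy
        rw [hy, Pi.add_apply, map_add, LinearMap.add_apply])
      (fun c u v => by
        rw [← integral_smul]
        refine integral_congr_ae ?_
        filter_upwards [Lp.coeFn_smul c u] with y hy
        rw [hy, Pi.smul_apply, map_smul, LinearMap.smul_apply])
      (fun u v v' => by
        rw [← integral_add (ha.integrable u v) (ha.integrable u v')]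
        refine integral_congr_ae ?_
        filter_upwards [Lp.coeFn_add v v'] with y hy
        rw [hy, Pi.add_apply, map_add])
      (fun c u v => by
        rw [← integral_smul]
        refine integral_congr_ae ?_
        filter_upwards [Lp.coeFn_smul c v] with y hy
        rw [hy, Pi.smul_apply, map_smul]))
    C ha.norm_integral_le

theorem lpForm_apply (ha : IsBoundedFormFamily μ a C) (u v : Lp H 2 μ) :
    ha.lpForm u v = ∫ y, a y (u y) (v y) ∂μ :=
  rfl

end NormedSpace

theorem mul_norm_sq_le_lpForm_self [NormedAddCommGroup H] [InnerProductSpace ℝ H]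
    {a : α → H →ₗ[ℝ] H →ₗ[ℝ] ℝ} {C c : ℝ} (ha : IsBoundedFormFamily μ a C) {S : Set H}
    (hcoer : ∀ᵐ y ∂μ, ∀ v ∈ S, c * ‖v‖ ^ 2 ≤ a y v v) {v : Lp H 2 μ} (hv : ∀ᵐ y ∂μ, v y ∈ S) :
    c * ‖v‖ ^ 2 ≤ ha.lpForm v v := by
  rw [← real_inner_self_eq_norm_sq, L2.inner_def, ← integral_const_mul, lpForm_apply]
  refine integral_mono_ae ((L2.integrable_inner v v).const_mul c) (ha.integrable v v) ?_
  filter_upwards [hcoer, hv] with y hy hvy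
  rw [real_inner_self_eq_norm_sq]
  exact hy _ hvy

end IsBoundedFormFamily

/-! ### Quadratic minimization under linear constraints -/

section QuadraticMinimization

variable {V : Type*} [AddCommGroup V] [Module ℝ V]

/-- The quadratic functional `v ↦ ½ A(v, v) - ℓ(v)`. -/
noncomputable def quadFunctional (A : LinearMap.BilinForm ℝ V) (ℓ : V →ₗ[ℝ] ℝ) (v : V) : ℝ :=
  1 / 2 * A v v - ℓ v

theorem quadFunctional_add {A : LinearMap.BilinForm ℝ V} (hA : ∀ v w, A v w = A w v)
    (ℓ : V →ₗ[ℝ] ℝ) (u v : V) : quadFunctional A ℓ (u + v) =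
      quadFunctional A ℓ u + (A u v - ℓ v) + 1 / 2 * A v v := by
  simp only [quadFunctional, map_add, LinearMap.add_apply, hA v u]
  ring

theorem quadFunctional_le_add_smul_iff {A : LinearMap.BilinForm ℝ V} (hA : ∀ v w, A v w = A w v)
    (hA₀ : ∀ v, 0 ≤ A v v) (ℓ : V →ₗ[ℝ] ℝ) (u v : V) :
    (∀ t : ℝ, quadFunctional A ℓ u ≤ quadFunctional A ℓ (u + t • v)) ↔ A u v = ℓ v := by
  have expand (t : ℝ) : quadFunctional A ℓ (u + t • v) = quadFunctional A ℓ u +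
      (1 / 2 * A v v * (t * t) + (A u v - ℓ v) * t + 0) := by
    simp only [quadFunctional_add hA, map_smul, LinearMap.smul_apply, smul_eq_mul]
    ring
  simp only [expand, le_add_iff_nonneg_right]
  constructor
  · intro h
    have hdiscrim : (A u v - ℓ v) ^ 2 ≤ 0 := by simpa [discrim] using discrim_le_zero h
    exact sub_eq_zero.1 (pow_eq_zero_iff two_ne_zero |>.1 (hdiscrim.antisymm (sq_nonneg _)))
  · intro h t
    rw [h, sub_self, zero_mul, add_zero, add_zero]
    exact mul_nonneg (mul_nonneg one_half_pos.le (hA₀ v)) (mul_self_nonneg t)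

end QuadraticMinimization

section LagrangeMultiplier

variable {H : Type*} [NormedAddCommGroup H] [InnerProductSpace ℝ H] {S : Submodule ℝ H}
  [CompleteSpace S] {c : ℝ}

theorem existsUnique_mem_forall_mem_eq_of_coercive (hc : 0 < c) {b : H →L[ℝ] H →L[ℝ] ℝ}
    (hb : ∀ w ∈ S, c * ‖w‖ ^ 2 ≤ b w w) (ℓ : H →L[ℝ] ℝ) :
    ∃! w, w ∈ S ∧ ∀ q ∈ S, b w q = ℓ q := by
  have hcoer : IsCoercive (b.bilinearComp S.subtypeL S.subtypeL) :=
    ⟨c, hc, fun w => by rw [mul_assoc, ← sq]; exact hb w w.2⟩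
  let e := hcoer.continuousLinearEquivOfBilin
  let r : S := (InnerProductSpace.toDual ℝ S).symm (ℓ.comp S.subtypeL)
  have hr (q : S) : inner ℝ r q = ℓ q := InnerProductSpace.toDual_symm_apply
  refine ⟨e.symm r, ⟨(e.symm r).2, fun q hq => ?_⟩, fun w ⟨hw, hwq⟩ => ?_⟩
  · have h := hcoer.continuousLinearEquivOfBilin_apply (e.symm r) ⟨q, hq⟩
    rw [e.apply_symm_apply, hr] at h
    exact h.symm
  · have h : r = e ⟨w, hw⟩ := hcoer.unique_continuousLinearEquivOfBilin fun q =>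
      (hr q).trans (hwq q q.2).symm
    rw [h, e.symm_apply_apply]

variable {V : Type*} [AddCommGroup V] [Module ℝ V] [TopologicalSpace V] {D : Submodule ℝ V}
  {B : V →L[ℝ] H →L[ℝ] ℝ} {j : H →L[ℝ] V}

-- Subtracting from `v` the image under `j` of the Lax–Milgram solution `w` of `B (j w) = B v` moves
-- `v` into the kernel of `B`, where `r` vanishes; so its values on `j S` determine `r`.
theorem forall_ker_eq_zero_iff_existsUnique_multiplier (hc : 0 < c)
    (hB : ∀ w ∈ S, c * ‖w‖ ^ 2 ≤ B (j w) w) (hj : ∀ w ∈ S, j w ∈ D) (r : V →L[ℝ] ℝ) :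
    (∀ v ∈ D, (∀ q ∈ S, B v q = 0) → r v = 0) ↔ ∃! p, p ∈ S ∧ ∀ v ∈ D, B v p = r v := by
  constructor
  · intro h
    obtain ⟨p, ⟨hp, hpr⟩, hunique⟩ :=
      existsUnique_mem_forall_mem_eq_of_coercive hc (b := (B ∘L j).flip) hB (r ∘L j)
    refine ⟨p, ⟨hp, fun v hv => ?_⟩, fun p' ⟨hp', hp'r⟩ =>
      hunique p' ⟨hp', fun w hw => hp'r _ (hj w hw)⟩⟩
    obtain ⟨w, ⟨hw, hwv⟩, -⟩ :=
      existsUnique_mem_forall_mem_eq_of_coercive hc (b := B ∘L j) hB (B v)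
    have hker : r (v - j w) = 0 := h _ (D.sub_mem hv (hj w hw)) fun q hq => by
      rw [map_sub, sub_apply, sub_eq_zero]
      exact (hwv q hq).symm
    calc B v p = B (j w) p := (hwv p hp).symm
      _ = r (j w) := hpr w hw
      _ = r v := by rw [map_sub, sub_eq_zero] at hker; exact hker.symm
  · rintro ⟨p, ⟨hp, hpr⟩, -⟩ v hv hker
    rw [← hpr v hv, hker p hp]

theorem forall_quadFunctional_le_iff_existsUnique_multiplier (hc : 0 < c)
    (hB : ∀ w ∈ S, c * ‖w‖ ^ 2 ≤ B (j w) w) (hj : ∀ w ∈ S, j w ∈ D) {A : V →L[ℝ] V →L[ℝ] ℝ}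
    (hA : ∀ v w, A v w = A w v) (hA₀ : ∀ v, 0 ≤ A v v) (ℓ : V →L[ℝ] ℝ) (u : V) :
    (∀ v ∈ D, (∀ q ∈ S, B v q = 0) →
      quadFunctional A.toLinearMap₁₂ ℓ u ≤ quadFunctional A.toLinearMap₁₂ ℓ (u + v)) ↔
      ∃! p, p ∈ S ∧ ∀ v ∈ D, A u v + B v p = ℓ v := by
  have hline (v : V) := quadFunctional_le_add_smul_iff (A := A.toLinearMap₁₂) hA hA₀ ℓ u v
  have hstationary : (∀ v ∈ D, (∀ q ∈ S, B v q = 0) →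
      quadFunctional A.toLinearMap₁₂ ℓ u ≤ quadFunctional A.toLinearMap₁₂ ℓ (u + v)) ↔
      ∀ v ∈ D, (∀ q ∈ S, B v q = 0) → (ℓ - A u) v = 0 := by
    refine ⟨fun h v hv hker => sub_eq_zero.2 ((hline v).1 fun t => h _ (D.smul_mem t hv) ?_).symm,
      fun h v hv hker => ?_⟩
    · intro q hq
      rw [map_smul, smul_apply, hker q hq, smul_zero]
    · simpa only [one_smul] using (hline v).2 (sub_eq_zero.1 (h v hv hker)).symm 1
  rw [hstationary, forall_ker_eq_zero_iff_existsUnique_multiplier hc hB hj]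
  simp only [sub_apply, eq_sub_iff_add_eq']

end LagrangeMultiplier

/-! ### Completeness of the function spaces -/

-- A shortcut that keeps unification of the nested `Lp` types feasible; it is scoped so that outside
-- this namespace statements elaborate with the instance found by search.
noncomputable scoped instance {d : ℕ} (Ω : Set (E d)) : NormedAddCommGroup (H1 Ω) :=
  (H1 Ω).normedAddCommGroup

section Completeness

theorem continuous_integral_smul_right_of_memLp {α G : Type*} [MeasurableSpace α] {μ : Measure α}
    [NormedAddCommGroup G] [NormedSpace ℝ G] [CompleteSpace G] {p q : ℝ≥0∞} [Fact (1 ≤ p)]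
    [Fact (1 ≤ q)] [p.HolderConjugate q] {g : α → G} (hg : MemLp g q μ) :
    Continuous fun u : Lp ℝ p μ => ∫ x, u x • g x ∂μ := by
  let pairing := (ContinuousLinearMap.lsmul ℝ ℝ : ℝ →L[ℝ] G →L[ℝ] G).lpPairing μ p q
  refine (pairing.flip hg.toLp).continuous.congr fun u => ?_
  rw [ContinuousLinearMap.flip_apply, ContinuousLinearMap.lpPairing_eq_integral]
  refine integral_congr_ae ?_
  filter_upwards [hg.coeFn_toLp] with x hx
  rw [hx, ContinuousLinearMap.lsmul_apply]

theorem continuous_integral_smul_left_of_memLp {α G : Type*} [MeasurableSpace α] {μ : Measure α}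
    [NormedAddCommGroup G] [NormedSpace ℝ G] [CompleteSpace G] {p q : ℝ≥0∞} [Fact (1 ≤ p)]
    [Fact (1 ≤ q)] [p.HolderConjugate q] {φ : α → ℝ} (hφ : MemLp φ p μ) :
    Continuous fun w : Lp G q μ => ∫ x, φ x • w x ∂μ := by
  let pairing := (ContinuousLinearMap.lsmul ℝ ℝ : ℝ →L[ℝ] G →L[ℝ] G).lpPairing μ p q
  refine (pairing hφ.toLp).continuous.congr fun w => ?_
  rw [ContinuousLinearMap.lpPairing_eq_integral]
  refine integral_congr_ae ?_
  filter_upwards [hφ.coeFn_toLp] with x hx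
  rw [hx, ContinuousLinearMap.lsmul_apply]

theorem isClosed_setOf_ae_mem {α G : Type*} [MeasurableSpace α] {μ : Measure α}
    [NormedAddCommGroup G] {p : ℝ≥0∞} [Fact (1 ≤ p)] {S : Set G} (hS : IsClosed S) :
    IsClosed {v : Lp G p μ | ∀ᵐ y ∂μ, v y ∈ S} := by
  refine IsSeqClosed.isClosed fun f v hf hv => ?_
  obtain ⟨φ, -, hφ⟩ := (tendstoInMeasure_of_tendsto_Lp hv).exists_seq_tendsto_ae
  filter_upwards [hφ, ae_all_iff.2 hf] with y hlim hmem
  exact hS.mem_of_tendsto hlim (Filter.Eventually.of_forall fun n => hmem (φ n))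

variable {d m : ℕ} (Ω : Set (E d)) (P : Measure (E m))

theorem isClosed_H1 : IsClosed (H1 Ω : Set (WithLp 2 (L2 Ω × L2vec Ω))) := by
  have hH1 : (H1 Ω : Set (WithLp 2 (L2 Ω × L2vec Ω))) = ⋂ (φ : E d → ℝ) (_ : ContDiff ℝ ∞ φ)
      (_ : HasCompactSupport φ) (_ : tsupport φ ⊆ Ω),
      {p | ∫ x in Ω, p.fst x • gradient φ x = -∫ x in Ω, φ x • p.snd x} := by
    ext p
    simp only [Set.mem_iInter]
    exact Iff.rfl
  rw [hH1]
  refine isClosed_iInter fun φ => isClosed_iInter fun hφ => isClosed_iInter fun hc =>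
    isClosed_iInter fun _ => isClosed_eq ?_ (Continuous.neg ?_)
  · exact (continuous_integral_smul_right_of_memLp (memLp_gradient Ω hφ hc)).comp
      (WithLp.fstL 2 ℝ (L2 Ω) (L2vec Ω)).continuous
  · have hφ₂ : MemLp φ 2 (volume.restrict Ω) :=
      (hφ.continuous.memLp_of_hasCompactSupport hc).restrict Ω
    exact (continuous_integral_smul_left_of_memLp hφ₂).comp
      (WithLp.sndL 2 ℝ (L2 Ω) (L2vec Ω)).continuous

instance : CompleteSpace (H1 Ω) :=
  (isClosed_H1 Ω).completeSpace_coe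

theorem isClosed_H10 : IsClosed (H10 Ω : Set (H1 Ω)) :=
  (smoothTraceGraph Ω).isClosed_topologicalClosure.preimage
    (ContinuousLinearMap.inl ℝ (H1 Ω) (L2Bdry Ω)).continuous

theorem isClosed_RH10 : IsClosed (RH10 Ω P : Set (RH1 Ω P)) :=
  isClosed_setOf_ae_mem (isClosed_H10 Ω)

instance : CompleteSpace (RH10 Ω P) :=
  (isClosed_RH10 Ω P).completeSpace_coe

end Completeness

/-! ### The forms `𝓐` and `𝓑` -/

section Forms

variable {d m : ℕ} {Ω : Set (E d)} {P : Measure (E m)}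

theorem norm_toL2_le (u : H1 Ω) : ‖H1.toL2 Ω u‖ ≤ ‖u‖ :=
  WithLp.norm_fst_le (x := (u : WithLp 2 (L2 Ω × L2vec Ω)))

theorem norm_toRL2_le (u : RH1 Ω P) : ‖RH1.toRL2 Ω P u‖ ≤ ‖u‖ := by
  refine Lp.norm_le_norm_of_ae_le ?_
  filter_upwards [(H1.toL2 Ω).coeFn_compLpL (p := 2) u] with y hy
  rw [RH1.toRL2, hy]
  exact norm_toL2_le _

theorem abs_inner_toRL2_le (f : RL2 Ω P) (q : RH1 Ω P) :
    |inner ℝ f (RH1.toRL2 Ω P q)| ≤ ‖f‖ * ‖q‖ :=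
  (abs_real_inner_le_norm _ _).trans (mul_le_mul_of_nonneg_left (norm_toRL2_le q) (norm_nonneg f))

theorem graphNorm_nonneg (U : UU Ω P) : 0 ≤ graphNorm U :=
  add_nonneg (norm_nonneg _) (norm_nonneg _)

theorem norm_mul_norm_add_le_graphNorm_mul (U W : UU Ω P) :
    ‖U.1‖ * ‖W.1‖ + ‖U.2‖ * ‖W.2‖ ≤ graphNorm U * graphNorm W := by
  have hcross : 0 ≤ ‖U.1‖ * ‖W.2‖ + ‖U.2‖ * ‖W.1‖ := by positivity
  rw [graphNorm, graphNorm]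
  linarith

theorem mul_add_mul_le_max_mul_add {R : Type*} [Semiring R] [LinearOrder R] [IsOrderedRing R]
    {x y : R} (hx : 0 ≤ x) (hy : 0 ≤ y) (b c : R) : b * x + c * y ≤ max b c * (x + y) := by
  rw [mul_add]
  gcongr
  · exact le_max_left _ _
  · exact le_max_right _ _

theorem aForm_zero_left (a : FormFamily m Ω) (v : RH1 Ω P) : aForm a 0 v = 0 := by
  refine integral_eq_zero_of_ae ?_
  filter_upwards [Lp.coeFn_zero (H1 Ω) 2 P] with y hy
  rw [hy, Pi.zero_apply, map_zero, LinearMap.zero_apply, Pi.zero_apply]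

theorem BForm_mk_zero (a : FormFamily m Ω) (w q : RH1 Ω P) : BForm a (w, 0) q = aForm a w q := by
  rw [BForm, inner_zero_left, sub_zero]

theorem AForm_comm (β : ℝ) (U W : UU Ω P) : AForm β U W = AForm β W U := by
  rw [AForm, AForm, real_inner_comm, real_inner_comm W.2]

theorem AForm_self (β : ℝ) (U : UU Ω P) :
    AForm β U U = ‖RH1.toRL2 Ω P U.1‖ ^ 2 + 2 * β * ‖U.2‖ ^ 2 := by
  rw [AForm, real_inner_self_eq_norm_sq, real_inner_self_eq_norm_sq]

section AForm

variable {β : ℝ} (hβ : 0 ≤ β)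
include hβ

theorem AForm_self_nonneg (U : UU Ω P) : 0 ≤ AForm β U U := by
  rw [AForm_self]
  positivity

theorem abs_AForm_le (U W : UU Ω P) :
    |AForm β U W| ≤ max 1 (2 * β) * graphNorm U * graphNorm W := by
  have hstate : |inner ℝ (RH1.toRL2 Ω P U.1) (RH1.toRL2 Ω P W.1)| ≤ ‖U.1‖ * ‖W.1‖ :=
    (abs_inner_toRL2_le _ _).trans (mul_le_mul_of_nonneg_right (norm_toRL2_le _) (norm_nonneg _))
  have hcontrol : |2 * β * inner ℝ U.2 W.2| ≤ 2 * β * (‖U.2‖ * ‖W.2‖) := by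
    rw [abs_mul, abs_of_nonneg (by positivity)]
    gcongr
    exact abs_real_inner_le_norm _ _
  calc |AForm β U W| ≤ 1 * (‖U.1‖ * ‖W.1‖) + 2 * β * (‖U.2‖ * ‖W.2‖) := by
        rw [one_mul]
        exact (abs_add_le _ _).trans (add_le_add hstate hcontrol)
    _ ≤ max 1 (2 * β) * (‖U.1‖ * ‖W.1‖ + ‖U.2‖ * ‖W.2‖) :=
        mul_add_mul_le_max_mul_add (by positivity) (by positivity) _ _
    _ ≤ max 1 (2 * β) * (graphNorm U * graphNorm W) := by
        gcongr
        exact norm_mul_norm_add_le_graphNorm_mul U W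
    _ = max 1 (2 * β) * graphNorm U * graphNorm W := (mul_assoc _ _ _).symm

end AForm

section Coercivity

variable {a : FormFamily m Ω} {c : ℝ} {U : UU Ω P}

theorem mul_norm_fst_le_norm_snd_of_mem_kerB
    (hcoer : ∀ v ∈ RH10 Ω P, c * ‖v‖ ^ 2 ≤ aForm a v v) (hker : U ∈ kerB a)
    (hU : U ∈ UU0 Ω P) : c * ‖U.1‖ ≤ ‖U.2‖ := by
  have henergy : c * ‖U.1‖ * ‖U.1‖ ≤ ‖U.2‖ * ‖U.1‖ :=
    calc c * ‖U.1‖ * ‖U.1‖ = c * ‖U.1‖ ^ 2 := by ring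
      _ ≤ aForm a U.1 U.1 := hcoer _ hU.1
      _ = inner ℝ U.2 (RH1.toRL2 Ω P U.1) := sub_eq_zero.1 (hker _ hU.1)
      _ ≤ ‖U.2‖ * ‖U.1‖ := (le_abs_self _).trans (abs_inner_toRL2_le _ _)
  rcases (norm_nonneg U.1).eq_or_lt with hzero | hpos
  · rw [← hzero, mul_zero]
    exact norm_nonneg _
  · exact le_of_mul_le_mul_right henergy hpos

theorem div_mul_graphNorm_le_norm_snd (hc : 0 < c) (hU : c * ‖U.1‖ ≤ ‖U.2‖) :
    c / (1 + c) * graphNorm U ≤ ‖U.2‖ := by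
  rw [div_mul_eq_mul_div, div_le_iff₀ (by positivity), graphNorm]
  linarith

theorem mul_graphNorm_sq_le_AForm_self (hc : 0 < c)
    (hcoer : ∀ v ∈ RH10 Ω P, c * ‖v‖ ^ 2 ≤ aForm a v v) {β : ℝ} (hβ : 0 ≤ β)
    (hker : U ∈ kerB a) (hU : U ∈ UU0 Ω P) :
    2 * β * (c / (1 + c)) ^ 2 * graphNorm U ^ 2 ≤ AForm β U U := by
  have hcontrol : c / (1 + c) * graphNorm U ≤ ‖U.2‖ :=
    div_mul_graphNorm_le_norm_snd hc (mul_norm_fst_le_norm_snd_of_mem_kerB hcoer hker hU)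
  have hnonneg : 0 ≤ c / (1 + c) * graphNorm U :=
    mul_nonneg (by positivity) (graphNorm_nonneg U)
  calc 2 * β * (c / (1 + c)) ^ 2 * graphNorm U ^ 2
      = 2 * β * (c / (1 + c) * graphNorm U) ^ 2 := by ring
    _ ≤ 2 * β * ‖U.2‖ ^ 2 := by gcongr
    _ ≤ AForm β U U := by
        rw [AForm_self]
        exact le_add_of_nonneg_left (sq_nonneg _)

end Coercivity

variable (Ω P) in
/-- The projection `(u, f) ↦ u` of `𝓤` to the state, regarded as an element of `𝓛²(Ω)`. -/
noncomputable def UU.toRL2 : UU Ω P →L[ℝ] RL2 Ω P :=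
  RH1.toRL2 Ω P ∘L ContinuousLinearMap.fst ℝ (RH1 Ω P) (RL2 Ω P)

/-- `AForm β` as a bounded bilinear form. -/
noncomputable def AFormL (β : ℝ) : UU Ω P →L[ℝ] UU Ω P →L[ℝ] ℝ :=
  (innerSL ℝ : RL2 Ω P →L[ℝ] RL2 Ω P →L[ℝ] ℝ).bilinearComp (UU.toRL2 Ω P) (UU.toRL2 Ω P) +
    (2 * β) • (innerSL ℝ : RL2 Ω P →L[ℝ] RL2 Ω P →L[ℝ] ℝ).bilinearComp
      (ContinuousLinearMap.snd ℝ (RH1 Ω P) (RL2 Ω P))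
      (ContinuousLinearMap.snd ℝ (RH1 Ω P) (RL2 Ω P))

namespace IsBoundedFormFamily

variable {a : FormFamily m Ω} {C : ℝ} (ha : IsBoundedFormFamily P a C)

/-- `BForm a` as a bounded bilinear form. -/
noncomputable def BFormL : UU Ω P →L[ℝ] RH1 Ω P →L[ℝ] ℝ :=
  ha.lpForm ∘L ContinuousLinearMap.fst ℝ (RH1 Ω P) (RL2 Ω P) -
    ((innerSL ℝ : RL2 Ω P →L[ℝ] RL2 Ω P →L[ℝ] ℝ).bilinearComp
      (ContinuousLinearMap.snd ℝ (RH1 Ω P) (RL2 Ω P)) (RH1.toRL2 Ω P) :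
      UU Ω P →L[ℝ] RH1 Ω P →L[ℝ] ℝ)

theorem BFormL_apply (U : UU Ω P) (q : RH1 Ω P) : ha.BFormL U q = BForm a U q :=
  rfl

include ha

theorem abs_BForm_le (U : UU Ω P) (q : RH1 Ω P) :
    |BForm a U q| ≤ max C 1 * graphNorm U * ‖q‖ :=
  calc |BForm a U q| ≤ |aForm a U.1 q| + |inner ℝ U.2 (RH1.toRL2 Ω P q)| := abs_sub _ _
    _ ≤ C * ‖U.1‖ * ‖q‖ + ‖U.2‖ * ‖q‖ :=
        add_le_add (ha.norm_integral_le U.1 q) (abs_inner_toRL2_le U.2 q)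
    _ = (C * ‖U.1‖ + 1 * ‖U.2‖) * ‖q‖ := by ring
    _ ≤ max C 1 * graphNorm U * ‖q‖ := by
        gcongr
        exact mul_add_mul_le_max_mul_add (norm_nonneg _) (norm_nonneg _) _ _

theorem bddAbove_range_BForm_div_graphNorm (q : RH1 Ω P) :
    BddAbove (Set.range fun U : {U : UU Ω P // U ≠ 0} => BForm a U.1 q / graphNorm U.1) := by
  refine ⟨max C 1 * ‖q‖, Set.forall_mem_range.2 fun U => ?_⟩
  refine div_le_of_le_mul₀ (graphNorm_nonneg _)
    (mul_nonneg (le_max_of_le_right zero_le_one) (norm_nonneg _)) ?_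
  rw [mul_right_comm]
  exact (le_abs_self _).trans (ha.abs_BForm_le U.1 q)

theorem mul_norm_le_iSup_BForm_div_graphNorm {c : ℝ} {q : RH1 Ω P}
    (hq : c * ‖q‖ ^ 2 ≤ aForm a q q) :
    c * ‖q‖ ≤ ⨆ U : {U : UU Ω P // U ≠ 0}, BForm a U.1 q / graphNorm U.1 := by
  rcases eq_or_ne q 0 with rfl | hq₀
  · rw [norm_zero, mul_zero]
    refine Real.iSup_nonneg fun U => ?_
    rw [← ha.BFormL_apply, map_zero, zero_div]
  · refine le_ciSup_of_le (ha.bddAbove_range_BForm_div_graphNorm q)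
      ⟨(q, 0), fun h => hq₀ (congrArg Prod.fst h)⟩ ?_
    rw [BForm_mk_zero, graphNorm, norm_zero, add_zero, le_div_iff₀ (norm_pos_iff.2 hq₀), mul_assoc,
      ← sq]
    exact hq

theorem mul_norm_sq_le_aForm_self {c : ℝ} (hcoer : ∀ᵐ y ∂P, ∀ v ∈ H10 Ω, c * ‖v‖ ^ 2 ≤ a y v v)
    {v : RH1 Ω P} (hv : v ∈ RH10 Ω P) : c * ‖v‖ ^ 2 ≤ aForm a v v :=
  ha.mul_norm_sq_le_lpForm_self hcoer hv

end IsBoundedFormFamily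

end Forms

/-! ### Saddle-point formulation and optimality system -/

section OptimalControl

variable {d m : ℕ} {Ω : Set (E d)} {P : Measure (E m)} {a : FormFamily m Ω} {C c β : ℝ}

namespace IsBoundedFormFamily

variable (ha : IsBoundedFormFamily P a C) {Uad : Set (UU Ω P)} {V : Submodule ℝ (UU Ω P)}
  (hV : ∀ U ∈ Uad, ∀ W, U + W ∈ Uad ↔ W ∈ V)
include ha hV

theorem isQuadMinimizer_iff_forall_quadCost_le_add (uhat : RL2 Ω P) (U : UU Ω P) :
    IsQuadMinimizer Uad a β uhat U ↔ (U ∈ Uad ∧ U ∈ kerB a) ∧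
      ∀ W ∈ V, W ∈ kerB a → quadCost β uhat U ≤ quadCost β uhat (U + W) := by
  refine and_congr_right fun ⟨hU, hker⟩ => ?_
  have hadd (W : UU Ω P) : U + W ∈ kerB a ↔ W ∈ kerB a := forall₂_congr fun q hq => by
    rw [← ha.BFormL_apply, map_add, add_apply, ha.BFormL_apply, hker q hq, zero_add,
      ha.BFormL_apply]
  refine ⟨fun hmin W hW hWker => hmin _ ⟨(hV U hU W).2 hW, (hadd W).2 hWker⟩,
    fun hmin W ⟨hW, hWker⟩ => ?_⟩
  rw [← add_sub_cancel U W] at hW hWker ⊢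
  exact hmin _ ((hV U hU _).1 hW) ((hadd _).1 hWker)

theorem isQuadMinimizer_iff_existsUnique_isSaddlePoint (hc : 0 < c)
    (hcoer : ∀ v ∈ RH10 Ω P, c * ‖v‖ ^ 2 ≤ aForm a v v) (hβ : 0 ≤ β)
    (hVstate : ∀ w ∈ RH10 Ω P, ((w, 0) : UU Ω P) ∈ V) (uhat : RL2 Ω P) (U : UU Ω P) :
    IsQuadMinimizer Uad a β uhat U ↔ ∃! lam : RH1 Ω P, IsSaddlePoint Uad V a β uhat U lam := by
  have hlift (w : RH1 Ω P) (hw : w ∈ RH10 Ω P) :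
      c * ‖w‖ ^ 2 ≤ ha.BFormL (ContinuousLinearMap.inl ℝ (RH1 Ω P) (RL2 Ω P) w) w := by
    rw [ha.BFormL_apply, ContinuousLinearMap.inl_apply, BForm_mk_zero]
    exact hcoer w hw
  have hmultiplier : (∀ W ∈ V, W ∈ kerB a → quadCost β uhat U ≤ quadCost β uhat (U + W)) ↔
      ∃! lam, lam ∈ RH10 Ω P ∧
        ∀ W ∈ V, AForm β U W + BForm a W lam = inner ℝ uhat (RH1.toRL2 Ω P W.1) :=
    forall_quadFunctional_le_iff_existsUnique_multiplier (B := ha.BFormL) (A := AFormL β)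
      (j := ContinuousLinearMap.inl ℝ (RH1 Ω P) (RL2 Ω P)) hc hlift hVstate (AForm_comm β)
      (AForm_self_nonneg hβ) (innerSL ℝ uhat ∘L UU.toRL2 Ω P) U
  rw [ha.isQuadMinimizer_iff_forall_quadCost_le_add hV, hmultiplier]
  exact ⟨fun ⟨⟨hU, hker⟩, lam, ⟨hlam, heq⟩, hunique⟩ =>
      ⟨lam, ⟨hU, hlam, heq, hker⟩, fun lam' ⟨_, hlam', heq', _⟩ => hunique lam' ⟨hlam', heq'⟩⟩,
    fun ⟨lam, ⟨hU, hlam, heq, hker⟩, hunique⟩ => ⟨⟨hU, hker⟩, lam, ⟨hlam, heq⟩,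
      fun lam' ⟨hlam', heq'⟩ => hunique lam' ⟨hU, hlam', heq', hker⟩⟩⟩

end IsBoundedFormFamily

theorem mem_UU0_iff {W : UU Ω P} : W ∈ UU0 Ω P ↔ W.1 ∈ RH10 Ω P :=
  and_iff_left Submodule.mem_top

theorem add_mem_dirichletSet_iff {g : L2Bdry Ω} {U : UU Ω P} (hU : U ∈ dirichletSet g)
    (W : UU Ω P) : U + W ∈ dirichletSet g ↔ W ∈ UU0 Ω P := by
  rw [mem_UU0_iff]
  change (∀ᵐ y ∂P, HasTrace Ω ((U + W).1 y) g) ↔ ∀ᵐ y ∂P, W.1 y ∈ H10 Ω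
  refine Filter.eventually_congr ?_
  have htrace : ∀ᵐ y ∂P, HasTrace Ω (U.1 y) g := hU
  filter_upwards [htrace, Lp.coeFn_add U.1 W.1] with y hy hadd
  rw [Prod.fst_add, hadd, Pi.add_apply, mem_H10, HasTrace, HasTrace,
    ← (traceGraph Ω).add_mem_iff_right hy (y := (W.1 y, 0)), Prod.mk_add_mk, add_zero]

theorem cost_eq_quadCost_add (β : ℝ) (uhat : RL2 Ω P) (U : UU Ω P) :
    cost β uhat U = quadCost β uhat U + 1 / 2 * ‖uhat‖ ^ 2 := by
  rw [cost, quadCost, AForm_self, norm_sub_sq_real, real_inner_comm]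
  ring

theorem isOptimalControl_iff_isQuadMinimizer (uhat : RL2 Ω P) (g : L2Bdry Ω) (U : UU Ω P) :
    IsOptimalControl a β uhat g U ↔ IsQuadMinimizer (dirichletSet g) a β uhat U := by
  simp only [IsOptimalControl, IsQuadMinimizer, BForm, sub_eq_zero, cost_eq_quadCost_add,
    add_le_add_iff_right]

theorem forall_mem_UU0_AForm_add_BForm_eq_iff (uhat : RL2 Ω P) (U : UU Ω P) (lam : RH1 Ω P) :
    (∀ W ∈ UU0 Ω P, AForm β U W + BForm a W lam = inner ℝ uhat (RH1.toRL2 Ω P W.1)) ↔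
      (∀ v ∈ RH10 Ω P,
        aForm a v lam = -inner ℝ (RH1.toRL2 Ω P U.1 - uhat) (RH1.toRL2 Ω P v)) ∧
      ∀ h : RL2 Ω P, 2 * β * inner ℝ U.2 h = inner ℝ h (RH1.toRL2 Ω P lam) := by
  refine ⟨fun hsaddle => ⟨fun v hv => ?_, fun h => ?_⟩, fun ⟨hadjoint, hgradient⟩ W hW => ?_⟩
  · have hstate := hsaddle (v, 0) (mem_UU0_iff.2 hv)
    rw [BForm_mk_zero, AForm, inner_zero_right, mul_zero, add_zero] at hstate
    rw [inner_sub_left]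
    linarith
  · have hcontrol := hsaddle (0, h) (mem_UU0_iff.2 (RH10 Ω P).zero_mem)
    rw [AForm, BForm, aForm_zero_left, map_zero, inner_zero_right, inner_zero_right] at hcontrol
    linarith
  · have hadjoint' := hadjoint W.1 hW.1
    have hgradient' := hgradient W.2
    rw [inner_sub_left] at hadjoint'
    rw [AForm, BForm]
    linarith

theorem isOptimalitySystemSol_iff_isSaddlePoint (uhat : RL2 Ω P) (g : L2Bdry Ω) (U : UU Ω P)
    (lam : RH1 Ω P) : IsOptimalitySystemSol a β uhat g U lam ↔
      IsSaddlePoint (dirichletSet g) (UU0 Ω P) a β uhat U lam := by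
  rw [IsSaddlePoint, forall_mem_UU0_AForm_add_BForm_eq_iff, and_comm (b := ∀ q ∈ RH10 Ω P, _)]
  simp only [IsOptimalitySystemSol, BForm, sub_eq_zero]

namespace IsBoundedFormFamily

variable (ha : IsBoundedFormFamily P a C) (hc : 0 < c)
  (hcoer : ∀ v ∈ RH10 Ω P, c * ‖v‖ ^ 2 ≤ aForm a v v) (hβ : 0 ≤ β)
include ha hc hcoer hβ

theorem isQuadMinimizer_univ_iff (uhat : RL2 Ω P) (U : UU Ω P) :
    IsQuadMinimizer Set.univ a β uhat U ↔
      ∃! lam : RH1 Ω P, IsSaddlePoint Set.univ ⊤ a β uhat U lam :=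
  ha.isQuadMinimizer_iff_existsUnique_isSaddlePoint
    (fun _ _ _ => iff_of_true (Set.mem_univ _) Submodule.mem_top) hc hcoer hβ
    (fun _ _ => Submodule.mem_top) uhat U

theorem isQuadMinimizer_dirichletSet_iff (uhat : RL2 Ω P) (g : L2Bdry Ω) (U : UU Ω P) :
    IsQuadMinimizer (dirichletSet g) a β uhat U ↔
      ∃! lam : RH1 Ω P, IsSaddlePoint (dirichletSet g) (UU0 Ω P) a β uhat U lam :=
  ha.isQuadMinimizer_iff_existsUnique_isSaddlePoint (fun _ hU => add_mem_dirichletSet_iff hU)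
    hc hcoer hβ (fun _ hw => mem_UU0_iff.2 hw) uhat U

theorem isOptimalControl_iff (uhat : RL2 Ω P) (g : L2Bdry Ω) (U : UU Ω P) :
    IsOptimalControl a β uhat g U ↔
      ∃! lam : RH1 Ω P, IsOptimalitySystemSol a β uhat g U lam := by
  simp only [isOptimalControl_iff_isQuadMinimizer, isOptimalitySystemSol_iff_isSaddlePoint,
    ha.isQuadMinimizer_dirichletSet_iff hc hcoer hβ]

end IsBoundedFormFamily

end OptimalControl

theorem ae_mem_paramMeasure {m : ℕ} {Γ : Set (E m)} (hΓ : MeasurableSet Γ) (ρ : E m → ℝ≥0∞) :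
    ∀ᵐ y ∂paramMeasure Γ ρ, y ∈ Γ :=
  (withDensity_absolutelyContinuous _ _).ae_le (ae_restrict_mem hΓ)

end StochOC

theorem mainTheorem2_general {d m : ℕ} {Ω : Set (StochOC.E d)} {P : Measure (StochOC.E m)}
    {a : StochOC.FormFamily m Ω}
    (ha_meas : ∀ u v : StochOC.H1 Ω, AEMeasurable (fun y => a y u v) P)
    {α₀ α₁ : ℝ} (hα₀ : 0 < α₀) (hα₁ : 0 ≤ α₁)
    (ha_coer : ∀ᵐ y ∂P, ∀ v ∈ StochOC.H10 Ω, α₀ * ‖v‖ ^ 2 ≤ a y v v)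
    (ha_bdd : ∀ᵐ y ∂P, ∀ u v : StochOC.H1 Ω, a y u v ≤ α₁ * ‖u‖ * ‖v‖)
    {β : ℝ} (hβ : 0 ≤ β) (uhat : StochOC.RL2 Ω P) (g : StochOC.L2Bdry Ω) :
    ((∀ U V : StochOC.UU Ω P, StochOC.AForm β U V = StochOC.AForm β V U) ∧
      (∀ U : StochOC.UU Ω P, 0 ≤ StochOC.AForm β U U) ∧
      (∀ U V : StochOC.UU Ω P, |StochOC.AForm β U V| ≤
        max 1 (2 * β) * StochOC.graphNorm U * StochOC.graphNorm V)) ∧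
    (∀ U : StochOC.UU Ω P, U ∈ StochOC.kerB a → U ∈ StochOC.UU0 Ω P →
      2 * β * (α₀ / (1 + α₀)) ^ 2 * StochOC.graphNorm U ^ 2 ≤ StochOC.AForm β U U) ∧
    ((∀ u v : StochOC.RH1 Ω P, Integrable (fun y => a y (u y) (v y)) P) ∧
      (∀ (U : StochOC.UU Ω P) (q : StochOC.RH1 Ω P),
        |StochOC.BForm a U q| ≤ max α₁ 1 * StochOC.graphNorm U * ‖q‖) ∧
      (∀ q ∈ StochOC.RH10 Ω P, α₀ * ‖q‖ ≤
        ⨆ U : {U : StochOC.UU Ω P // U ≠ 0},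
          StochOC.BForm a U.1 q / StochOC.graphNorm U.1)) ∧
    (∀ U : StochOC.UU Ω P, StochOC.IsQuadMinimizer Set.univ a β uhat U ↔
      ∃! lam : StochOC.RH1 Ω P, StochOC.IsSaddlePoint Set.univ ⊤ a β uhat U lam) ∧
    (∀ U : StochOC.UU Ω P, StochOC.IsQuadMinimizer (StochOC.dirichletSet g) a β uhat U ↔
      ∃! lam : StochOC.RH1 Ω P,
        StochOC.IsSaddlePoint (StochOC.dirichletSet g) (StochOC.UU0 Ω P) a β uhat U lam) ∧
    (∀ U : StochOC.UU Ω P, StochOC.IsOptimalControl a β uhat g U ↔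
      ∃! lam : StochOC.RH1 Ω P, StochOC.IsOptimalitySystemSol a β uhat g U lam) := by
  have ha : StochOC.IsBoundedFormFamily P a α₁ := ⟨ha_meas, hα₁, ha_bdd⟩
  have hcoer : ∀ v ∈ StochOC.RH10 Ω P, α₀ * ‖v‖ ^ 2 ≤ StochOC.aForm a v v :=
    fun _ hv => ha.mul_norm_sq_le_aForm_self ha_coer hv
  exact ⟨⟨StochOC.AForm_comm β, StochOC.AForm_self_nonneg hβ, StochOC.abs_AForm_le hβ⟩,
    fun _ => StochOC.mul_graphNorm_sq_le_AForm_self hα₀ hcoer hβ,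
    ⟨ha.integrable, ha.abs_BForm_le,
      fun q hq => ha.mul_norm_le_iSup_BForm_div_graphNorm (hcoer q hq)⟩,
    ha.isQuadMinimizer_univ_iff hα₀ hcoer hβ uhat,
    ha.isQuadMinimizer_dirichletSet_iff hα₀ hcoer hβ uhat g,
    ha.isOptimalControl_iff hα₀ hcoer hβ uhat g⟩

theorem mainTheorem2 {d m : ℕ} (hd : 1 ≤ d)
    (Ω : Set (StochOC.E d)) (hΩ : StochOC.IsConvexPolygonalDomain Ω)
    -- the random vector `X : D → Γ ⊆ ℝᵐ` and its joint density `ρ`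
    {D : Type*} [MeasurableSpace D] (Pr : Measure D) [IsProbabilityMeasure Pr] [Pr.IsComplete]
    (Γ : Set (StochOC.E m)) (hΓ : MeasurableSet Γ)
    (X : D → StochOC.E m) (hX : Measurable X) (hXΓ : ∀ s, X s ∈ Γ)
    (ρ : StochOC.E m → ℝ≥0∞) (hρ : Measurable ρ) (hlaw : Pr.map X = volume.withDensity ρ)
    (P : Measure (StochOC.E m)) (hP : P = StochOC.paramMeasure Γ ρ)
    -- the bilinear forms `a(·,·;μ)`
    (a : StochOC.FormFamily m Ω)
    (ha_meas : ∀ u v : StochOC.H1 Ω, AEMeasurable (fun y => a y u v) P)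
    (α₀ α₁ : ℝ) (hα₀ : 0 < α₀) (hα₁ : 0 < α₁)
    (ha_coer : ∀ y ∈ Γ, ∀ v ∈ StochOC.H10 Ω, α₀ * ‖v‖ ^ 2 ≤ a y v v)
    (ha_bdd : ∀ y ∈ Γ, ∀ u v : StochOC.H1 Ω, a y u v ≤ α₁ * ‖u‖ * ‖v‖)
    (β : ℝ) (hβ : 0 < β) (uhat : StochOC.RL2 Ω P) (g : StochOC.L2Bdry Ω) :
    -- `𝓐` is symmetric, nonnegative and continuous on `𝓤`
    ((∀ U V : StochOC.UU Ω P, StochOC.AForm β U V = StochOC.AForm β V U) ∧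
      (∀ U : StochOC.UU Ω P, 0 ≤ StochOC.AForm β U U) ∧
      (∀ U V : StochOC.UU Ω P, |StochOC.AForm β U V| ≤
        max 1 (2 * β) * StochOC.graphNorm U * StochOC.graphNorm V)) ∧
    -- `𝓐` is coercive on the kernel of `𝓑`
    (∀ U : StochOC.UU Ω P, U ∈ StochOC.kerB a → U ∈ StochOC.UU0 Ω P →
      2 * β * (α₀ / (1 + α₀)) ^ 2 * StochOC.graphNorm U ^ 2 ≤ StochOC.AForm β U U) ∧
    -- `𝓑` is well defined, continuous and satisfies the inf-sup condition
    ((∀ u v : StochOC.RH1 Ω P, Integrable (fun y => a y (u y) (v y)) P) ∧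
      (∀ (U : StochOC.UU Ω P) (q : StochOC.RH1 Ω P),
        |StochOC.BForm a U q| ≤ max α₁ 1 * StochOC.graphNorm U * ‖q‖) ∧
      (∀ q ∈ StochOC.RH10 Ω P, α₀ * ‖q‖ ≤
        ⨆ U : {U : StochOC.UU Ω P // U ≠ 0},
          StochOC.BForm a U.1 q / StochOC.graphNorm U.1)) ∧
    -- quadratic minimization and saddle-point formulation, on all of `𝓤`
    (∀ U : StochOC.UU Ω P, StochOC.IsQuadMinimizer Set.univ a β uhat U ↔
      ∃! lam : StochOC.RH1 Ω P, StochOC.IsSaddlePoint Set.univ ⊤ a β uhat U lam) ∧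
    -- quadratic minimization and saddle-point formulation, with the Dirichlet condition
    (∀ U : StochOC.UU Ω P, StochOC.IsQuadMinimizer (StochOC.dirichletSet g) a β uhat U ↔
      ∃! lam : StochOC.RH1 Ω P,
        StochOC.IsSaddlePoint (StochOC.dirichletSet g) (StochOC.UU0 Ω P) a β uhat U lam) ∧
    -- original control problem and optimality system
    (∀ U : StochOC.UU Ω P, StochOC.IsOptimalControl a β uhat g U ↔
      ∃! lam : StochOC.RH1 Ω P, StochOC.IsOptimalitySystemSol a β uhat g U lam) := by
  subst hP
  have hmem := StochOC.ae_mem_paramMeasure hΓ ρ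
  exact mainTheorem2_general ha_meas hα₀ hα₁.le (hmem.mono ha_coer) (hmem.mono ha_bdd) hβ.le uhat g
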